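/- Let $q$ be a prime power, and for integers $n,k\ge 0$ put $\left[{n\atop k}\right]_q=\prod_{0\le i\le k-1}\frac{q^{n-i}-1}{q^{k-i}-1}$ (the Gaussian binomial coefficient, which is $0$ for $k>n$). Let $\mathcal L=\{l_1,\dots,l_s\}$ be a set of $s\ge 1$ positive integers with $0<l_1<l_2<\cdots<l_s$, and let $\mathbb F_q$ be a finite field of order $q$. Let $\mathcal V$ be a collection of subspaces of an $n$-dimensional vector space over $\mathbb F_q$ such that $\dim(V_i\cap V_j)\in\mathcal L$ for any two distinct subspaces $V_i,V_j\in\mathcal V$, and let $k=\max_{V\in\mathcal V}\dim V$ (with $k=0$ if $\mathcal V$ is empty). If $$n\ \ge\ \max\left\{\log_q\left((q^s-1)\left[{k^2\atop l_1+1}\right]_q+1\right)+l_1,\ \ 2s+1\right\},$$ then $$|\mathcal V|<\left[{n\atop s}\right]_q .$$ -/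

import Mathlib

/-- The Gaussian binomial coefficient `[n, k]_q = ∏_{0 ≤ i ≤ k - 1} (q^(n-i) - 1) / (q^(k-i) - 1)`.
For `k > n` the factor with `i = n` is zero, so the value is `0`; for `k ≤ n` no natural-number
subtraction in it truncates. -/
noncomputable def gaussBinom (q n k : ℕ) : ℝ :=
  ∏ i ∈ Finset.range k, ((q : ℝ) ^ (n - i) - 1) / ((q : ℝ) ^ (k - i) - 1)

/-- The maximum dimension of a member of a finite family of subspaces (`0` for the empty family). -/
noncomputable def maxDim {F W : Type*} [Field F] [AddCommGroup W] [Module F W]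
    (V : Finset (Submodule F W)) : ℕ :=
  V.sup fun U => Module.finrank F U

open Module

/-! The engine is a Frankl–Wilson bound (`card_le_sum_gaussBinom`), proved by linear independence of
functions on subspaces, and its quotient form for members sharing a subspace `T`. If the common
intersection has dimension at least `l₁ ≥ 1`, all members share a line; the quotient bound sums row
`n - 1` up to `s`, which is less than `[n, s]`.

Otherwise all members meet one `M` of dimension at most `k ^ 2` in dimension at least `l₁ + 1`. The
members through a given `(l₁ + 1)`-subspace of `M` no longer realise `l₁`, so there are at most `[n
- 1, s - 1]` of them. Thus `|V| ≤ [k ^ 2, l₁ + 1] [n - 1, s - 1]`, and the bound on `n` puts this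
below `[n, s] = [n - 1, s - 1] (q ^ n - 1) / (q ^ s - 1)`. -/

/-! ### Gaussian binomials: recurrences and row sums -/

theorem gaussBinom_nonneg {q : ℕ} (hq : 2 ≤ q) (n k : ℕ) : 0 ≤ gaussBinom q n k := by
  have h1 : (1 : ℝ) ≤ q := by exact_mod_cast (by omega : 1 ≤ q)
  exact Finset.prod_nonneg fun i _ => div_nonneg
    (sub_nonneg.2 (one_le_pow₀ h1)) (sub_nonneg.2 (one_le_pow₀ h1))

theorem gaussBinom_mono {q : ℕ} (hq : 2 ≤ q) {m n : ℕ} (hmn : m ≤ n) (k : ℕ) :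
    gaussBinom q m k ≤ gaussBinom q n k := by
  have h1 : (1 : ℝ) ≤ q := by exact_mod_cast (by omega : 1 ≤ q)
  refine Finset.prod_le_prod (fun i _ => div_nonneg
    (sub_nonneg.2 (one_le_pow₀ h1)) (sub_nonneg.2 (one_le_pow₀ h1))) fun i _ => ?_
  have := sub_nonneg.2 (one_le_pow₀ h1 (n := k - i))
  gcongr

@[simp] theorem gaussBinom_zero_right (q n : ℕ) : gaussBinom q n 0 = 1 := by
  simp [gaussBinom]

theorem gaussBinom_eq_zero_of_lt (q : ℕ) {n k : ℕ} (h : n < k) : gaussBinom q n k = 0 :=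
  Finset.prod_eq_zero (Finset.mem_range.2 h) (by simp)

theorem gaussBinom_eq_div (q n k : ℕ) : gaussBinom q n k =
    (∏ i ∈ Finset.range k, ((q : ℝ) ^ (n - i) - 1)) /
      ∏ i ∈ Finset.range k, ((q : ℝ) ^ (i + 1) - 1) := by
  rw [gaussBinom, Finset.prod_div_distrib, ← Finset.prod_range_reflect (fun i => (q : ℝ) ^ (i + 1) - 1)]
  congr 1
  refine Finset.prod_congr rfl fun i hi => ?_
  have := Finset.mem_range.1 hi
  congr 2
  omega

theorem pow_succ_sub_one_pos {q : ℕ} (hq : 2 ≤ q) (k : ℕ) : (0 : ℝ) < (q : ℝ) ^ (k + 1) - 1 := by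
  have h1 : (1 : ℝ) < q := by exact_mod_cast (by omega : 1 < q)
  exact sub_pos.2 (one_lt_pow₀ h1 (by omega))

theorem gaussBinom_succ_right {q : ℕ} (hq : 2 ≤ q) (n k : ℕ) :
    gaussBinom q n (k + 1) * ((q : ℝ) ^ (k + 1) - 1) =
      gaussBinom q n k * ((q : ℝ) ^ (n - k) - 1) := by
  have hd : ∏ i ∈ Finset.range k, ((q : ℝ) ^ (i + 1) - 1) ≠ 0 :=
    Finset.prod_ne_zero_iff.2 fun i _ => (pow_succ_sub_one_pos hq i).ne'
  have hk := (pow_succ_sub_one_pos hq k).ne'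
  rw [gaussBinom_eq_div, gaussBinom_eq_div, Finset.prod_range_succ, Finset.prod_range_succ]
  field_simp

theorem gaussBinom_succ_succ_mul {q : ℕ} (hq : 2 ≤ q) (n k : ℕ) :
    gaussBinom q (n + 1) (k + 1) * ((q : ℝ) ^ (k + 1) - 1) =
      gaussBinom q n k * ((q : ℝ) ^ (n + 1) - 1) := by
  have hd : ∏ i ∈ Finset.range k, ((q : ℝ) ^ (i + 1) - 1) ≠ 0 :=
    Finset.prod_ne_zero_iff.2 fun i _ => (pow_succ_sub_one_pos hq i).ne'
  have hk := (pow_succ_sub_one_pos hq k).ne'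
  rw [gaussBinom_eq_div, gaussBinom_eq_div, Finset.prod_range_succ', Finset.prod_range_succ]
  simp only [Nat.add_sub_add_right, Nat.sub_zero]
  field_simp

theorem gaussBinom_succ_succ {q : ℕ} (hq : 2 ≤ q) {n k : ℕ} (hk : k ≤ n) :
    gaussBinom q (n + 1) (k + 1) =
      gaussBinom q n k + (q : ℝ) ^ (k + 1) * gaussBinom q n (k + 1) := by
  have h0 := pow_succ_sub_one_pos hq k
  refine mul_right_cancel₀ h0.ne' ?_
  rw [gaussBinom_succ_succ_mul hq, add_mul, mul_assoc, gaussBinom_succ_right hq]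
  have : (q : ℝ) ^ (n + 1) = (q : ℝ) ^ (k + 1) * (q : ℝ) ^ (n - k) := by
    rw [← pow_add]; congr 1; omega
  rw [this]; ring

theorem gaussBinom_le_succ_right {q : ℕ} (hq : 2 ≤ q) {n k : ℕ} (h : 2 * k + 1 ≤ n) :
    gaussBinom q n k ≤ gaussBinom q n (k + 1) := by
  have h0 := pow_succ_sub_one_pos hq k
  refine le_of_mul_le_mul_right ?_ h0
  rw [gaussBinom_succ_right hq]
  refine mul_le_mul_of_nonneg_left ?_ (gaussBinom_nonneg hq _ _)
  have h1 : (1 : ℝ) ≤ q := by exact_mod_cast (by omega : 1 ≤ q)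
  gcongr
  omega

theorem gaussBinom_le_of_le {q : ℕ} (hq : 2 ≤ q) {n i k : ℕ} (hik : i ≤ k) (h : 2 * k ≤ n + 1) :
    gaussBinom q n i ≤ gaussBinom q n k := by
  induction k, hik using Nat.le_induction with
  | base => rfl
  | succ k _ ih => exact (ih (by omega)).trans (gaussBinom_le_succ_right hq (by omega))

/-- The lower half of a row of Gaussian binomials, summed up to the `k`-th entry, is at most the
`k`-th entry of the next row. -/
theorem sum_gaussBinom_le {q : ℕ} (hq : 2 ≤ q) {n k : ℕ} (h : 2 * k ≤ n + 1) (hk : k ≤ n) :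
    ∑ i ∈ Finset.range (k + 1), gaussBinom q n i ≤ gaussBinom q (n + 1) k := by
  rcases k with _ | k
  · simp
  · have h1 : ∑ i ∈ Finset.range k, gaussBinom q n i ≤ k * gaussBinom q n (k + 1) := by
      refine (Finset.sum_le_card_nsmul _ _ (gaussBinom q n (k + 1)) fun i hi => ?_).trans (by simp)
      exact gaussBinom_le_of_le hq (by have := Finset.mem_range.1 hi; omega) h
    have h2 : (k + 1 : ℝ) ≤ (q : ℝ) ^ (k + 1) := by
      exact_mod_cast (Nat.lt_pow_self (by omega : 1 < q)).le
    rw [Finset.sum_range_succ, Finset.sum_range_succ, gaussBinom_succ_succ hq (by omega)]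
    nlinarith [gaussBinom_nonneg hq n (k + 1)]

theorem gaussBinom_pos {q : ℕ} (hq : 2 ≤ q) {n k : ℕ} (hk : k ≤ n) : 0 < gaussBinom q n k := by
  refine Finset.prod_pos fun i hi => ?_
  have hi := Finset.mem_range.1 hi
  obtain ⟨a, ha⟩ : ∃ a, n - i = a + 1 := ⟨n - i - 1, by omega⟩
  obtain ⟨b, hb⟩ : ∃ b, k - i = b + 1 := ⟨k - i - 1, by omega⟩
  rw [ha, hb]
  exact div_pos (pow_succ_sub_one_pos hq a) (pow_succ_sub_one_pos hq b)

/-- The `k + 1` terms other than `[n, k]` are each at most `[n, k + 1]`, and `k + 1 < q ^ (k + 1)`,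
so Pascal's rule gives strict inequality. -/
theorem sum_gaussBinom_lt {q : ℕ} (hq : 2 ≤ q) {n k : ℕ} (h : 2 * (k + 1) ≤ n + 1) :
    ∑ i ∈ Finset.range (k + 2), gaussBinom q n i < gaussBinom q (n + 1) (k + 1) := by
  have h1 : ∑ i ∈ Finset.range k, gaussBinom q n i ≤ k * gaussBinom q n (k + 1) := by
    refine (Finset.sum_le_card_nsmul _ _ (gaussBinom q n (k + 1)) fun i hi => ?_).trans (by simp)
    exact gaussBinom_le_of_le hq (by have := Finset.mem_range.1 hi; omega) h
  have h2 : (k + 1 : ℝ) < (q : ℝ) ^ (k + 1) := by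
    exact_mod_cast Nat.lt_pow_self (by omega : 1 < q)
  rw [Finset.sum_range_succ, Finset.sum_range_succ, gaussBinom_succ_succ hq (by omega)]
  nlinarith [gaussBinom_pos hq (by omega : k + 1 ≤ n)]

/-! ### Counting subspaces -/

/-- The number of `k`-dimensional subspaces of a finite-dimensional space over a finite field. -/
theorem card_submodule_finrank_eq {F W : Type*} [Field F] [Fintype F] [AddCommGroup W]
    [Module F W] [FiniteDimensional F W] (k : ℕ) :
    (Nat.card {T : Submodule F W // finrank F T = k} : ℝ) =
      gaussBinom (Fintype.card F) (finrank F W) k := by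
  classical
  have hq : 2 ≤ Fintype.card F := Fintype.one_lt_card
  have : Finite W := Module.finite_of_finite F
  rcases lt_or_ge (finrank F W) k with h | h
  · rw [gaussBinom_eq_zero_of_lt _ h]
    have : IsEmpty {T : Submodule F W // finrank F T = k} :=
      ⟨fun T => by have := T.1.finrank_le; have := T.2; omega⟩
    simp
  · let φ : {v : Fin k → W // LinearIndependent F v} → {T : Submodule F W // finrank F T = k} :=
      fun v => ⟨Submodule.span F (Set.range v.1), by
        rw [finrank_span_eq_card v.2, Fintype.card_fin]⟩
    have hf : ∀ T, Nat.card {v // φ v = T} =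
        ∏ i : Fin k, (Fintype.card F ^ k - Fintype.card F ^ i.val) := fun T => by
      let e : {v // φ v = T} ≃ {v : Fin k → T.1 // LinearIndependent F v} :=
        { toFun := fun v => ⟨fun i => ⟨v.1.1 i, 
              congrArg Subtype.val v.2 ▸ Submodule.subset_span ⟨i, rfl⟩⟩,
            LinearIndependent.of_comp (Submodule.subtype _) v.1.2⟩
          invFun := fun v =>
            have hv : LinearIndependent F fun i => (v.1 i : W) :=
              v.2.map' (Submodule.subtype _) (Submodule.ker_subtype _)
            ⟨⟨_, hv⟩, Subtype.ext (Submodule.eq_of_le_of_finrank_eq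
              (Submodule.span_le.2 (by rintro _ ⟨i, rfl⟩; exact (v.1 i).2))
              (by rw [T.2, finrank_span_eq_card hv, Fintype.card_fin]))⟩
          left_inv := fun v => rfl
          right_inv := fun v => rfl }
      have := card_linearIndependent (K := F) (V := T.1) T.2.ge
      rw [T.2] at this
      rw [Nat.card_congr e]
      exact this
    have hc := Nat.card_congr (Equiv.sigmaFiberEquiv φ)
    have := Fintype.ofFinite {T : Submodule F W // finrank F T = k}
    rw [card_linearIndependent h, Nat.card_sigma, Finset.sum_congr rfl fun T _ => hf T,
      Finset.sum_const, Finset.card_univ, smul_eq_mul, ← Nat.card_eq_fintype_card] at hc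
    clear hf φ
    generalize Fintype.card F = q at *
    have key : ∀ m, k ≤ m → ((∏ i : Fin k, (q ^ m - q ^ i.val) : ℕ) : ℝ) =
        ∏ i ∈ Finset.range k, ((q : ℝ) ^ i * ((q : ℝ) ^ (m - i) - 1)) := fun m hm => by
      rw [Nat.cast_prod, ← Fin.prod_univ_eq_prod_range
        (fun i => (q : ℝ) ^ i * ((q : ℝ) ^ (m - i) - 1))]
      refine Finset.prod_congr rfl fun i _ => ?_
      rw [Nat.cast_sub (Nat.pow_le_pow_right (by omega) (by omega)), mul_sub, ← pow_add]
      simp [show i.val + (m - i) = m by omega]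
    have hR := congrArg (Nat.cast (R := ℝ)) hc
    rw [Nat.cast_mul, key _ h, key _ le_rfl, Finset.prod_mul_distrib, Finset.prod_mul_distrib] at hR
    have hq0 : ∏ i ∈ Finset.range k, (q : ℝ) ^ i ≠ 0 :=
      Finset.prod_ne_zero_iff.2 fun i _ => pow_ne_zero _ (by norm_cast; omega)
    have hk0 : ∏ i ∈ Finset.range k, ((q : ℝ) ^ (k - i) - 1) ≠ 0 :=
      Finset.prod_ne_zero_iff.2 fun i hi => by
        have hi := Finset.mem_range.1 hi
        obtain ⟨b, hb⟩ : ∃ b, k - i = b + 1 := ⟨k - i - 1, by omega⟩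
        rw [hb]
        exact (pow_succ_sub_one_pos hq b).ne'
    rw [gaussBinom, Finset.prod_div_distrib, eq_div_iff hk0]
    refine mul_left_cancel₀ hq0 ?_
    linarith

/-! ### The Frankl–Wilson bound for subspaces -/

/-- The indicator function of the up-set of subspaces containing `T`. -/
noncomputable def upIndicator {F W : Type*} [Field F] [AddCommGroup W] [Module F W]
    (T U : Submodule F W) : ℝ :=
  open Classical in if T ≤ U then 1 else 0

theorem upIndicator_sup {F W : Type*} [Field F] [AddCommGroup W] [Module F W]
    (S T U : Submodule F W) :
    upIndicator (S ⊔ T) U = upIndicator S U * upIndicator T U := by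
  by_cases h1 : S ≤ U <;> by_cases h2 : T ≤ U <;> simp [upIndicator, h1, h2]

theorem pow_finrank_inf_eq_sum {F W : Type*} [Field F] [Fintype F] [AddCommGroup W] [Module F W]
    [Fintype W] (A U : Submodule F W) :
    (Fintype.card F : ℝ) ^ finrank F (A ⊓ U : Submodule F W) =
      ∑ x : W, (open Classical in if x ∈ A then 1 else 0) * upIndicator (Submodule.span F {x}) U := by
  classical
  have h := Module.card_eq_pow_finrank (K := F) (V := (A ⊓ U : Submodule F W))
  rw [← Nat.cast_pow, ← h, Fintype.card_subtype, Finset.card_filter, Nat.cast_sum]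
  refine Finset.sum_congr rfl fun x _ => ?_
  by_cases h1 : x ∈ A <;> by_cases h2 : x ∈ U <;> simp [upIndicator, h1, h2]

section

variable {F W : Type*} [Field F] [Fintype F] [AddCommGroup W] [Module F W] [FiniteDimensional F W]

/-- The power of `q` counts the `x ∈ A` lying in `U`, and multiplying the indicators of `span {x}`
and `T` gives that of their join: one factor raises the dimension by at most one. -/
theorem mul_mem_span_upIndicator (A : Submodule F W) (c : ℝ) (r : ℕ) (g : Submodule F W → ℝ)
    (hg : g ∈ Submodule.span ℝ (upIndicator '' {T : Submodule F W | finrank F T ≤ r})) :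
    (fun U => ((Fintype.card F : ℝ) ^ finrank F (A ⊓ U : Submodule F W) - c) * g U) ∈
      Submodule.span ℝ (upIndicator '' {T : Submodule F W | finrank F T ≤ r + 1}) := by
  classical
  have : Finite W := Module.finite_of_finite F
  have := Fintype.ofFinite W
  induction hg using Submodule.span_induction with
  | mem g hg =>
    obtain ⟨T, hT, rfl⟩ := hg
    have hT : finrank F T ≤ r := hT
    have h : (fun U => ((Fintype.card F : ℝ) ^ finrank F (A ⊓ U : Submodule F W) - c) *
        upIndicator T U) = (∑ x : W, (if x ∈ A then (1 : ℝ) else 0) •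
          upIndicator (Submodule.span F {x} ⊔ T)) - c • upIndicator T := by
      ext U
      simp only [Pi.sub_apply, Finset.sum_apply, Pi.smul_apply, smul_eq_mul, upIndicator_sup]
      rw [sub_mul, pow_finrank_inf_eq_sum, Finset.sum_mul]
      congr 1
      refine Finset.sum_congr rfl fun x _ => ?_
      rw [mul_assoc]
    rw [h]
    refine sub_mem (sum_mem fun x _ => Submodule.smul_mem _ _ (Submodule.subset_span ⟨_, ?_, rfl⟩))
      (Submodule.smul_mem _ _ (Submodule.subset_span ⟨_, ?_, rfl⟩))
    · have h1 := Submodule.finrank_add_le_finrank_add_finrank (Submodule.span F {x}) T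
      have h2 := finrank_span_le_card (R := F) ({x} : Set W)
      simp only [Set.toFinset_singleton, Finset.card_singleton] at h2
      show finrank F _ ≤ r + 1
      omega
    · show finrank F T ≤ r + 1
      omega
  | zero => simp only [Pi.zero_apply, mul_zero]; exact zero_mem _
  | add g h _ _ hg hh => simp only [Pi.add_apply, mul_add]; exact add_mem hg hh
  | smul a g _ hg =>
    have := Submodule.smul_mem _ a hg
    convert this using 2 with U
    simp only [Pi.smul_apply, smul_eq_mul]
    ring

theorem prod_mem_span_upIndicator (A : Submodule F W) (c : ℕ → ℝ) (L : Finset ℕ) :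
    (fun U => ∏ l ∈ L, ((Fintype.card F : ℝ) ^ finrank F (A ⊓ U : Submodule F W) - c l)) ∈
      Submodule.span ℝ (upIndicator '' {T : Submodule F W | finrank F T ≤ L.card}) := by
  classical
  induction L using Finset.induction_on with
  | empty =>
    refine Submodule.subset_span ⟨⊥, by simp, ?_⟩
    ext U
    simp [upIndicator]
  | insert a L ha ih =>
    rw [Finset.card_insert_of_notMem ha]
    simp only [Finset.prod_insert ha]
    exact mul_mem_span_upIndicator A _ _ _ ih

theorem card_submodule_finrank_le [Finite W] (r : ℕ) :
    (Nat.card {T : Submodule F W // finrank F T ≤ r} : ℝ) =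
      ∑ i ∈ Finset.range (r + 1), gaussBinom (Fintype.card F) (finrank F W) i := by
  classical
  have := Fintype.ofFinite (Submodule F W)
  simp only [← card_submodule_finrank_eq (F := F) (W := W), Nat.card_eq_fintype_card,
    Fintype.card_subtype]
  rw [← Nat.cast_sum, Finset.card_eq_sum_card_fiberwise (f := fun T : Submodule F W => finrank F T)
    (t := Finset.range (r + 1))]
  · congr 1
    refine Finset.sum_congr rfl fun i hi => ?_
    rw [Finset.filter_filter]
    congr 1
    ext T
    have := Finset.mem_range.1 hi
    simp only [Finset.mem_filter, Finset.mem_univ, true_and]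
    omega
  · intro T hT
    simpa [Nat.lt_succ_iff] using hT

/-- The vector space version of the nonuniform Frankl–Wilson theorem: a family of subspaces whose
pairwise intersections have dimensions in a set of `s` integers has at most as many members as there
are subspaces of dimension at most `s`. -/
theorem card_le_sum_gaussBinom (V : Finset (Submodule F W)) (L : Finset ℕ)
    (hV : ∀ A ∈ V, ∀ B ∈ V, A ≠ B → finrank F (A ⊓ B : Submodule F W) ∈ L) :
    (V.card : ℝ) ≤
      ∑ i ∈ Finset.range (L.card + 1), gaussBinom (Fintype.card F) (finrank F W) i := by
  classical
  have : Finite W := Module.finite_of_finite F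
  have := Fintype.ofFinite (Submodule F W)
  have hq : 1 < (Fintype.card F : ℝ) := by exact_mod_cast Fintype.one_lt_card
  rw [← card_submodule_finrank_le]
  -- Keeping only `l < dim A` makes the value at `A` nonzero; ordering by dimension then makes the
  -- system triangular.
  let f : V → Submodule F W → ℝ := fun A U => ∏ l ∈ L.filter (· < finrank F A.1),
    ((Fintype.card F : ℝ) ^ finrank F (A.1 ⊓ U : Submodule F W) - (Fintype.card F : ℝ) ^ l)
  have hdiag : ∀ A, f A A.1 ≠ 0 := fun A => by
    refine Finset.prod_ne_zero_iff.2 fun l hl => ?_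
    rw [inf_idem]
    exact (sub_pos.2 (pow_lt_pow_right₀ hq (Finset.mem_filter.1 hl).2)).ne'
  have htri : ∀ A B : V, A ≠ B → finrank F B.1 ≤ finrank F A.1 → f A B.1 = 0 := fun A B hAB h => by
    have hne : A.1 ≠ B.1 := fun h => hAB (Subtype.ext h)
    refine Finset.prod_eq_zero (i := finrank F (A.1 ⊓ B.1 : Submodule F W))
      (Finset.mem_filter.2 ⟨hV _ A.2 _ B.2 hne, ?_⟩) (sub_self _)
    by_contra hlt
    have h1 : A.1 ⊓ B.1 = A.1 := Submodule.eq_of_le_of_finrank_le inf_le_left (not_lt.1 hlt)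
    exact hne (Submodule.eq_of_le_of_finrank_le (inf_eq_left.1 h1) h)
  have hli : LinearIndependent ℝ f := by
    rw [Fintype.linearIndependent_iff]
    by_contra! hc
    obtain ⟨c, hc, A, hA⟩ := hc
    obtain ⟨B, hB, hmin⟩ := Finset.exists_min_image (Finset.univ.filter fun B => c B ≠ 0)
      (fun B : V => finrank F B.1) ⟨A, by simpa using hA⟩
    have := congrFun hc B.1
    simp only [Finset.sum_apply, Pi.smul_apply, smul_eq_mul, Pi.zero_apply] at this
    rw [Finset.sum_eq_single B] at this
    · exact mul_ne_zero (Finset.mem_filter.1 hB).2 (hdiag B) this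
    · intro D _ hD
      by_cases h0 : c D = 0
      · simp [h0]
      · rw [htri D B hD (hmin D (by simpa using h0)), mul_zero]
    · simp
  have hspan : Submodule.span ℝ (Set.range f) ≤ Submodule.span ℝ (Set.range
      fun T : {T : Submodule F W // finrank F T ≤ L.card} => upIndicator T.1) := by
    refine Submodule.span_le.2 ?_
    rintro _ ⟨A, rfl⟩
    refine Submodule.span_mono ?_ (prod_mem_span_upIndicator A.1 _ _)
    rintro _ ⟨T, hT, rfl⟩
    exact ⟨⟨T, le_trans hT (Finset.card_filter_le _ _)⟩, rfl⟩
  have h1 := finrank_span_eq_card hli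
  have h2 := Submodule.finrank_mono hspan
  have h3 := finrank_range_le_card (R := ℝ)
    fun T : {T : Submodule F W // finrank F T ≤ L.card} => upIndicator T.1
  rw [Fintype.card_coe] at h1
  rw [Nat.card_eq_fintype_card]
  exact_mod_cast h1 ▸ h2.trans h3

theorem finrank_map_mkQ_add_finrank {F W : Type*} [Field F] [AddCommGroup W] [Module F W]
    [FiniteDimensional F W] {T A : Submodule F W} (h : T ≤ A) :
    finrank F (A.map T.mkQ) + finrank F T = finrank F A := by
  have h1 := LinearMap.finrank_range_add_finrank_ker (T.mkQ.domRestrict A)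
  rw [LinearMap.range_domRestrict, LinearMap.ker_domRestrict, Submodule.ker_mkQ] at h1
  rwa [(Submodule.comapSubtypeEquivOfLe h).finrank_eq] at h1

/-- If moreover all members of the family contain a subspace `T`, one may pass to the quotient by
`T`. -/
theorem card_le_sum_gaussBinom_of_forall_le (V : Finset (Submodule F W)) (L : Finset ℕ)
    (T : Submodule F W) (hT : ∀ A ∈ V, T ≤ A)
    (hV : ∀ A ∈ V, ∀ B ∈ V, A ≠ B → finrank F (A ⊓ B : Submodule F W) ∈ L) :
    (V.card : ℝ) ≤ ∑ i ∈ Finset.range (L.card + 1),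
      gaussBinom (Fintype.card F) (finrank F W - finrank F T) i := by
  classical
  have hq : 2 ≤ Fintype.card F := Fintype.one_lt_card
  have hcomap : ∀ A ∈ V, (A.map T.mkQ).comap T.mkQ = A := fun A hA => by
    rw [Submodule.comap_map_mkQ, sup_eq_right.2 (hT A hA)]
  have hinj : Set.InjOn (Submodule.map T.mkQ) (V : Set (Submodule F W)) := fun A hA B hB h => by
    rw [← hcomap A hA, ← hcomap B hB, h]
  have hinf : ∀ A ∈ V, ∀ B ∈ V, A.map T.mkQ ⊓ B.map T.mkQ = (A ⊓ B).map T.mkQ :=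
    fun A hA B hB => by
      refine Submodule.comap_injective_of_surjective T.mkQ_surjective ?_
      rw [Submodule.comap_inf, hcomap A hA, hcomap B hB, Submodule.comap_map_mkQ,
        sup_eq_right.2 (le_inf (hT A hA) (hT B hB))]
  -- Truncated subtraction may merge values, which only shrinks the image of `L`.
  have key := card_le_sum_gaussBinom (V.image (Submodule.map T.mkQ))
    (L.image fun l => l - finrank F T) (by
      simp only [Finset.mem_image]
      rintro _ ⟨A, hA, rfl⟩ _ ⟨B, hB, rfl⟩ hne
      refine ⟨_, hV A hA B hB fun h => hne (by rw [h]), ?_⟩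
      rw [hinf A hA B hB]
      have := finrank_map_mkQ_add_finrank (le_inf (hT A hA) (hT B hB))
      omega)
  rw [Finset.card_image_of_injOn hinj] at key
  have hd : finrank F (W ⧸ T) = finrank F W - finrank F T := by
    have := T.finrank_quotient_add_finrank
    omega
  rw [hd] at key
  refine key.trans (Finset.sum_le_sum_of_subset_of_nonneg ?_ fun i _ _ => gaussBinom_nonneg hq _ _)
  exact Finset.range_subset_range.2 (Nat.succ_le_succ Finset.card_image_le)

end

/-! ### Families with small common intersection -/

section

variable {F W : Type*} [Field F] [AddCommGroup W] [Module F W] [FiniteDimensional F W]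

/-- Finitely many members of the family, whose span has controlled dimension, already have an
intersection of dimension less than `l` if the whole family has. -/
theorem exists_subset_finrank_inf_lt (V : Finset (Submodule F W)) {k l : ℕ}
    (hk : ∀ A ∈ V, finrank F A ≤ k)
    (hl : ∀ A ∈ V, ∀ B ∈ V, l ≤ finrank F (A ⊓ B : Submodule F W))
    (hinf : finrank F (V.inf id : Submodule F W) < l) {A₀ : Submodule F W} (hA₀ : A₀ ∈ V) (t : ℕ) :
    ∃ S ⊆ V, A₀ ∈ S ∧ finrank F (S.sup id : Submodule F W) ≤ k + t * (k - l) ∧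
      (finrank F (S.inf id : Submodule F W) < l ∨ finrank F (S.inf id : Submodule F W) + t ≤ k) := by
  classical
  induction t with
  | zero => exact ⟨{A₀}, by simpa using hA₀, by simp,
      by rw [Finset.sup_singleton, id, zero_mul, add_zero]; exact hk _ hA₀,
      Or.inr (by rw [Finset.inf_singleton, id, add_zero]; exact hk _ hA₀)⟩
  | succ t ih =>
    obtain ⟨S, hSV, hAS, hsup, hS⟩ := ih
    rw [add_mul, one_mul]
    by_cases hlt : finrank F (S.inf id : Submodule F W) < l
    · exact ⟨S, hSV, hAS, by omega, Or.inl hlt⟩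
    · obtain ⟨B, hB, hBS⟩ : ∃ B ∈ V, ¬ S.inf id ≤ B := by
        by_contra! h
        exact hlt ((Submodule.finrank_mono (Finset.le_inf h)).trans_lt hinf)
      -- `B` meets `A₀` in dimension at least `l`, so the span grows by at most `k - l`, while the
      -- intersection strictly drops.
      refine ⟨insert B S, Finset.insert_subset hB hSV, Finset.mem_insert_of_mem hAS, ?_, Or.inr ?_⟩
      · rw [Finset.sup_insert, id]
        have h1 := Submodule.finrank_sup_add_finrank_inf_eq B (S.sup id)
        have h2 := Submodule.finrank_mono (inf_le_inf_left B (Finset.le_sup (f := id) hAS))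
        have h3 := hl B hB A₀ hA₀
        have h4 := hk B hB
        simp only [id] at h2
        omega
      · rw [Finset.inf_insert, id]
        have h1 : B ⊓ S.inf id < S.inf id := inf_lt_right.2 hBS
        have h2 := Submodule.finrank_lt_finrank_of_lt h1
        omega

/-- If the members of a family of at most `k`-dimensional subspaces pairwise meet in dimension at
least `l`, but have a common intersection of dimension less than `l`, then they all meet some fixed
subspace of dimension at most `k ^ 2` in dimension more than `l`. -/
theorem exists_finrank_le_sq_and_lt_finrank_inf (V : Finset (Submodule F W)) {k l : ℕ}
    (hV : V.Nonempty) (hk : ∀ A ∈ V, finrank F A ≤ k)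
    (hl : ∀ A ∈ V, ∀ B ∈ V, l ≤ finrank F (A ⊓ B : Submodule F W))
    (hinf : finrank F (V.inf id : Submodule F W) < l) :
    ∃ M : Submodule F W, finrank F M ≤ k ^ 2 ∧
      ∀ A ∈ V, l + 1 ≤ finrank F (A ⊓ M : Submodule F W) := by
  obtain ⟨A₀, hA₀⟩ := hV
  -- After `k - l + 1` steps both alternatives give dimension below `l`.
  obtain ⟨S, hSV, hAS, hsup, hS⟩ := exists_subset_finrank_inf_lt V hk hl hinf hA₀ (k - l + 1)
  have hlk : l ≤ k := ((hl _ hA₀ _ hA₀).trans (Submodule.finrank_mono inf_le_left)).trans (hk _ hA₀)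
  have hS : finrank F (S.inf id : Submodule F W) < l := by omega
  refine ⟨S.sup id, hsup.trans ?_, fun A hA => ?_⟩
  · obtain ⟨d, rfl⟩ := Nat.exists_eq_add_of_le hlk
    obtain ⟨m, rfl⟩ : ∃ m, l = m + 1 := ⟨l - 1, by omega⟩
    rw [Nat.add_sub_cancel_left]
    nlinarith [Nat.zero_le (m * d), Nat.zero_le (m * m)]
  -- If `A` met the span in dimension at most `l`, then `A ⊓ B` would equal that trace for every `B
  -- ∈ S`, forcing it into the too small `S.inf id`.
  · by_contra hlt
    have hle : ∀ B ∈ S, A ⊓ B ≤ A ⊓ S.sup id := fun B hB =>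
      inf_le_inf_left A (Finset.le_sup (f := id) hB)
    have h1 : A ⊓ S.sup id ≤ S.inf id := Finset.le_inf fun B hB => by
      have h2 := hl A hA B (hSV hB)
      rw [← Submodule.eq_of_le_of_finrank_le (hle B hB) (by omega)]
      exact inf_le_right
    have h3 := Submodule.finrank_mono h1
    have h4 := Submodule.finrank_mono (hle _ hAS)
    have h5 := hl A hA _ (hSV hAS)
    omega

end

/-! ### Covering by subspaces of a fixed space -/

section

variable {F W : Type*} [Field F] [Fintype F] [AddCommGroup W] [Module F W] [FiniteDimensional F W]

theorem exists_le_finrank_eq (A : Submodule F W) {d : ℕ} (h : d ≤ finrank F A) :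
    ∃ T ≤ A, finrank F T = d := by
  have hp : 0 < (Nat.card {T : Submodule F A // finrank F T = d} : ℝ) := by
    rw [card_submodule_finrank_eq]
    exact gaussBinom_pos Fintype.one_lt_card h
  obtain ⟨⟨T, hT⟩⟩ := (Nat.card_pos_iff.1 (by exact_mod_cast hp)).1
  exact ⟨T.map A.subtype, Submodule.map_subtype_le _ _, by
    rw [Submodule.finrank_map_subtype_eq, hT]⟩

/-- Counting a family all of whose members meet `M` in dimension at least `d`, by the
`d`-dimensional subspaces of `M` they contain. -/
theorem card_le_gaussBinom_mul (V : Finset (Submodule F W)) (M : Submodule F W) {d : ℕ} {b : ℝ}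
    (hM : ∀ A ∈ V, d ≤ finrank F (A ⊓ M : Submodule F W))
    (hb : ∀ T : Submodule F W, finrank F T = d →
      ∀ V' ⊆ V, (∀ A ∈ V', T ≤ A) → (V'.card : ℝ) ≤ b) :
    (V.card : ℝ) ≤ gaussBinom (Fintype.card F) (finrank F M) d * b := by
  classical
  have : Finite W := Module.finite_of_finite F
  have := Fintype.ofFinite {T : Submodule F M // finrank F T = d}
  have hsub : V ⊆ (Finset.univ : Finset {T : Submodule F M // finrank F T = d}).biUnion
      fun T => V.filter (T.1.map M.subtype ≤ ·) := fun A hA => by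
    obtain ⟨T, hT, hd⟩ := exists_le_finrank_eq _ (hM A hA)
    have hmap : (T.comap M.subtype).map M.subtype = T := by
      rw [Submodule.map_comap_subtype, inf_eq_right.2 (hT.trans inf_le_right)]
    refine Finset.mem_biUnion.2 ⟨⟨T.comap M.subtype, ?_⟩, Finset.mem_univ _,
      Finset.mem_filter.2 ⟨hA, ?_⟩⟩
    · rw [← Submodule.finrank_map_subtype_eq, hmap, hd]
    · rw [hmap]
      exact hT.trans inf_le_left
  have h1 := (Finset.card_le_card hsub).trans Finset.card_biUnion_le
  rw [← card_submodule_finrank_eq (F := F) (W := M), Nat.card_eq_fintype_card, ← Finset.card_univ,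
    ← nsmul_eq_mul]
  refine (Nat.cast_le.2 h1).trans ?_
  rw [Nat.cast_sum]
  refine Finset.sum_le_card_nsmul _ _ _ fun T _ => hb (T.1.map M.subtype) ?_ _
    (Finset.filter_subset _ _) fun A hA => (Finset.mem_filter.1 hA).2
  rw [Submodule.finrank_map_subtype_eq, T.2]

end

/-! ### The main theorem -/

theorem theorem1p15 {F W : Type*} [Field F] [Fintype F] [AddCommGroup W] [Module F W]
    [FiniteDimensional F W] (q n s k l₁ : ℕ)
    (hq : Fintype.card F = q) (hn : Module.finrank F W = n)
    (L : Finset ℕ) (hs : L.card = s) (hpos : ∀ l ∈ L, 0 < l) (hl₁ : IsLeast (L : Set ℕ) l₁)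
    (V : Finset (Submodule F W))
    (hV : ∀ A ∈ V, ∀ B ∈ V, A ≠ B → Module.finrank F (A ⊓ B : Submodule F W) ∈ L)
    (hk : k = maxDim V)
    (hbound : (n : ℝ) ≥
      max (Real.logb q (((q : ℝ) ^ s - 1) * gaussBinom q (k ^ 2) (l₁ + 1) + 1) + l₁) (2 * s + 1)) :
    (V.card : ℝ) < gaussBinom q n s := by
  classical
  have hq2 : 2 ≤ q := hq ▸ Fintype.one_lt_card
  have hq1 : (1 : ℝ) < q := by exact_mod_cast hq2
  obtain ⟨hlog, hns⟩ := max_le_iff.1 hbound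
  have hns : 2 * s + 1 ≤ n := by exact_mod_cast hns
  have hlL : l₁ ∈ L := hl₁.1
  have hlpos := hpos _ hlL
  obtain ⟨r, rfl⟩ : ∃ r, s = r + 1 :=
    ⟨s - 1, by have := Finset.card_pos.2 ⟨_, hlL⟩; omega⟩
  obtain ⟨m, rfl⟩ : ∃ m, n = m + 1 := ⟨n - 1, by omega⟩
  have hsum := sum_gaussBinom_lt hq2 (n := m) (k := r) (by omega)
  rcases le_or_gt l₁ (finrank F (V.inf id : Submodule F W)) with hinf | hinf
  · obtain ⟨T, hT, hT1⟩ := exists_le_finrank_eq (V.inf id) (hlpos.trans_le hinf)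
    have key := card_le_sum_gaussBinom_of_forall_le V L T
      (fun A hA => hT.trans (Finset.inf_le (f := id) hA)) hV
    rw [hs, hq, hn, hT1] at key
    exact key.trans_lt hsum
  -- A lone member may have dimension below `l₁`; with two members, each contains an intersection of
  -- dimension at least `l₁`.
  rcases le_or_gt V.card 1 with hc | hc
  · have h1 : gaussBinom q m 0 ≤ ∑ i ∈ Finset.range (r + 2), gaussBinom q m i :=
      Finset.single_le_sum (f := gaussBinom q m) (fun i _ => gaussBinom_nonneg hq2 _ _) (by simp)
    rw [gaussBinom_zero_right] at h1
    have hc : (V.card : ℝ) ≤ 1 := by exact_mod_cast hc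
    linarith
  have hl : ∀ A ∈ V, ∀ B ∈ V, l₁ ≤ finrank F (A ⊓ B : Submodule F W) := fun A hA B hB => by
    by_cases hAB : A = B
    · subst hAB
      obtain ⟨C, hC, hCA⟩ := Finset.exists_mem_ne hc A
      rw [inf_idem]
      exact (hl₁.2 (hV A hA C hC hCA.symm)).trans (Submodule.finrank_mono inf_le_left)
    · exact hl₁.2 (hV A hA B hB hAB)
  obtain ⟨M, hM, hVM⟩ := exists_finrank_le_sq_and_lt_finrank_inf V (k := k)
    (Finset.card_pos.1 (by omega))
    (fun A hA => hk ▸ Finset.le_sup (f := fun U : Submodule F W => finrank F U) hA) hl hinf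
  have hcard := card_le_gaussBinom_mul V M hVM (b := gaussBinom q m r) fun T hT V' hV' hTV' => by
    have key := card_le_sum_gaussBinom_of_forall_le V' (L.erase l₁) T hTV'
      fun A hA B hB hAB => Finset.mem_erase.2 ⟨fun h => by
        have := Submodule.finrank_mono (le_inf (hTV' A hA) (hTV' B hB))
        omega, hV A (hV' hA) B (hV' hB) hAB⟩
    rw [Finset.card_erase_of_mem hlL, hs, hq, hn, hT, Nat.add_sub_cancel] at key
    -- Since `l₁ ≥ 1`, the quotient by `T` has dimension at most `n - 2`, here `p`.
    obtain ⟨p, rfl⟩ : ∃ p, m = p + 1 := ⟨m - 1, by omega⟩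
    exact (key.trans (Finset.sum_le_sum fun i _ => gaussBinom_mono hq2 (by omega) i)).trans
      (sum_gaussBinom_le hq2 (by omega) (by omega))
  rw [hq] at hcard
  have hcard := hcard.trans (mul_le_mul_of_nonneg_right (gaussBinom_mono hq2 hM _)
    (gaussBinom_nonneg hq2 _ _))
  -- This keeps the exponent `m + 1 - l₁` from truncating.
  have hln : l₁ ≤ m + 1 := by
    obtain ⟨A, hA⟩ := Finset.card_pos.1 (by omega : 0 < V.card)
    exact hn ▸ (hl A hA A hA).trans (Submodule.finrank_le _)
  have hs0 := pow_succ_sub_one_pos hq2 r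
  have hpow : ((q : ℝ) ^ (r + 1) - 1) * gaussBinom q (k ^ 2) (l₁ + 1) + 1 ≤
      (q : ℝ) ^ (m + 1 - l₁) := by
    have h0 := mul_nonneg hs0.le (gaussBinom_nonneg hq2 (k ^ 2) (l₁ + 1))
    rw [← Real.rpow_natCast _ (m + 1 - l₁), ← Real.logb_le_iff_le_rpow hq1 (by linarith),
      Nat.cast_sub hln]
    linarith
  have hlt : (q : ℝ) ^ (m + 1 - l₁) < (q : ℝ) ^ (m + 1) := pow_lt_pow_right₀ hq1 (by omega)
  have hg := gaussBinom_pos hq2 (by omega : r ≤ m)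
  refine lt_of_mul_lt_mul_right ?_ hs0.le
  rw [gaussBinom_succ_succ_mul hq2]
  calc (V.card : ℝ) * ((q : ℝ) ^ (r + 1) - 1)
      ≤ gaussBinom q (k ^ 2) (l₁ + 1) * gaussBinom q m r * ((q : ℝ) ^ (r + 1) - 1) :=
        mul_le_mul_of_nonneg_right hcard hs0.le
    _ = gaussBinom q m r * (((q : ℝ) ^ (r + 1) - 1) * gaussBinom q (k ^ 2) (l₁ + 1)) := by ring
    _ < gaussBinom q m r * ((q : ℝ) ^ (m + 1) - 1) := mul_lt_mul_of_pos_left (by linarith) hg
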